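/- For a positive integer $q$ let $[q]=\{1,\dots,q\}$, let $\Delta[q]$ be the simplex of probability measures on $[q]$, and let $\gamma$ be the standard (uniform, that is, normalized Lebesgue) probability measure on $\Delta[q]$. An edge partition of the complete graph $K_n$ on the vertex set $[n]$ is an ordered partition $(E_1,\dots,E_q)$ of the edge set of $K_n$ into $q$ (possibly empty) parts. For a permutation $\sigma$ of $[n]$ put $\sigma(E_i)=\{\{\sigma(u),\sigma(v)\}:\{u,v\}\in E_i\}$. A function $A$ from the set of edge partitions of $K_n$ to $[q]$ is called a graph property if $A(\sigma(E_1),\dots,\sigma(E_q))=A(E_1,\dots,E_q)$ for every edge partition $(E_1,\dots,E_q)$ and every permutation $\sigma$ of $[n]$. A graph property $A$ is called monotone if for all edge partitions $(E_1,\dots,E_q)$, $(F_1,\dots,F_q)$ and every $i\in[q]$ such that $E_i\subseteq F_i$, $F_j\subseteq E_j$ for all $j\ne i$, and $A(E_1,\dots,E_q)=i$, it holds that $A(F_1,\dots,F_q)=i$. For $\mu\in\Delta[q]$ let $\mathbb{P}_\mu[A=i]$ be the probability that $A(E_1,\dots,E_q)=i$ when each edge of $K_n$ is labeled independently with a random element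 of $[q]$ of law $\mu$, and $E_j$ is the set of the edges labeled by $j$. Corollary. For every positive integer $q$ there is a constant $C=C(q)>0$ such that for every $n\ge 3$, every monotone graph property $A$ of edge partitions of $K_n$ into $q$ parts, every $i\in[q]$ and every $0<\varepsilon\le 1/2$, $$\gamma\bigl(\{\mu\in\Delta[q] : \varepsilon\le \mathbb{P}_\mu[A=i]\le 1-\varepsilon\}\bigr)\le C\,\bigl(\log(1-\varepsilon)-\log\varepsilon\bigr)\,\frac{\log\log n}{\log n}.$$ -/

import Mathlib

open MeasureTheory

namespace GraphThreshold

/-- The edges of the complete graph `K_n` on the vertex set `Fin n`: the unordered pairs of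
distinct vertices. -/
def edges (n : ℕ) : Set (Sym2 (Fin n)) := (⊤ : SimpleGraph (Fin n)).edgeSet

/-- An ordered partition `(E_1, …, E_q)` of the edges of `K_n` into `q` parts. Parts may be
empty. -/
structure EdgePartition (n q : ℕ) where
  part : Fin q → Set (Sym2 (Fin n))
  disjoint : ∀ i j, i ≠ j → Disjoint (part i) (part j)
  iUnion_part : ⋃ i, part i = edges n

/-- The partition whose `i`-th part is the set of the edges labeled by `i`. -/
def EdgePartition.ofLabeling {n q : ℕ} (x : edges n → Fin q) : EdgePartition n q where
  part i := {e | ∃ h : e ∈ edges n, x ⟨e, h⟩ = i}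
  disjoint i j hij := by
    rw [Set.disjoint_left]
    rintro e ⟨_, hi⟩ ⟨_, hj⟩
    exact hij (hi.symm.trans hj)
  iUnion_part := by
    ext e
    simp

/-- `σ (E_i) = {{σ u, σ v} : {u, v} ∈ E_i}` for a permutation `σ` of the vertices. -/
def EdgePartition.perm {n q : ℕ} (σ : Equiv.Perm (Fin n)) (E : EdgePartition n q) :
    EdgePartition n q where
  part i := Sym2.map σ '' E.part i
  disjoint i j hij :=
    (Set.disjoint_image_iff (Sym2.map.injective σ.injective)).2 (E.disjoint i j hij)
  iUnion_part := by
    rw [← Set.image_iUnion, E.iUnion_part]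
    ext e
    constructor
    · rintro ⟨d, hd, rfl⟩
      induction d with
      | _ u v => simpa [edges] using hd
    · intro he
      refine ⟨Sym2.map σ.symm e, ?_, ?_⟩
      · induction e with
        | _ u v => simpa [edges] using he
      · rw [Sym2.map_map]
        simp

/-- A graph property: a function of edge partitions that is invariant under all permutations of
the vertices. -/
def IsGraphProperty {n q : ℕ} (A : EdgePartition n q → Fin q) : Prop :=
  ∀ (E : EdgePartition n q) (σ : Equiv.Perm (Fin n)), A (E.perm σ) = A E

/-- A monotone graph property: enlarging the `i`-th part at the expense of the other parts
preserves the value `i`. -/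
structure IsMonotoneGraphProperty {n q : ℕ} (A : EdgePartition n q → Fin q) : Prop where
  isGraphProperty : IsGraphProperty A
  monotone : ∀ (E F : EdgePartition n q) (i : Fin q), E.part i ⊆ F.part i →
    (∀ j, j ≠ i → F.part j ⊆ E.part j) → A E = i → A F = i

noncomputable section

/-- The measure on the colors `Fin q` that gives mass `μ i` to the color `i`. -/
def colorLaw {q : ℕ} (μ : Fin q → ℝ) : Measure (Fin q) :=
  ∑ i, ENNReal.ofReal (μ i) • Measure.dirac i

instance (n : ℕ) : Fintype (edges n) := inferInstanceAs (Fintype (⊤ : SimpleGraph (Fin n)).edgeSet)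

/-- The law of the labeling in which every edge of `K_n` receives a label with law `μ`,
independently for different edges. -/
def labelingLaw (n : ℕ) {q : ℕ} (μ : Fin q → ℝ) : Measure (edges n → Fin q) :=
  Measure.pi fun _ => colorLaw μ

/-- The probability `P_μ[A = i]`. -/
def prob {n q : ℕ} (μ : Fin q → ℝ) (A : EdgePartition n q → Fin q) (i : Fin q) : ℝ :=
  (labelingLaw n μ).real {x | A (EdgePartition.ofLabeling x) = i}

/-- The solid simplex of the possible first `m` coordinates of a point of the standard simplex
in `ℝ^(m + 1)`. -/
def solidSimplex (m : ℕ) : Set (Fin m → ℝ) := {y | (∀ j, 0 ≤ y j) ∧ ∑ j, y j ≤ 1}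

/-- The standard probability measure on the simplex `stdSimplex ℝ (Fin q)`, as a measure on
`ℝ^q`: the normalized `(q - 1)`-dimensional Lebesgue measure, in the coordinates given by
all the entries but the last. There is no simplex for `q = 0`. -/
def simplexMeasure : (q : ℕ) → Measure (Fin q → ℝ)
  | 0 => 0
  | m + 1 => Measure.map (fun y : Fin m → ℝ => (Fin.snoc y (1 - ∑ j, y j) : Fin (m + 1) → ℝ))
      (ProbabilityTheory.cond volume (solidSimplex m))

end

end GraphThreshold

/-! Fix `i`, let `f` be the indicator of `A = i`, and move the law of the labels along `direction
i`, which takes mass at the same rate from every other symbol and gives it to `i`. By Russo's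
formula and monotonicity the derivative of the mean of `f` is its total energy: the sum over edges
`e` and symbols `j` of the mean squared change of `f` when `e` is switched from `i` to `j`
(`hasDerivAt_expect`).

The sum over `j` carries no weights, so the energy controls entropy with the constant 16 for every
law, even near the boundary of the simplex (`entropy_le_energy`). Vertex symmetry gives all `N`
edges the same energy. Applying the logarithmic Sobolev inequality to the successive martingale
differences of `f`, in the manner of Falik and Samorodnitsky, shows that the energy is at least `log
N / 32` times the variance (`variance_mul_log_le_energy`).

Hence the log-odds of `A = i` grow at rate at least `log N / 32`, and every line in this direction
meets the threshold window in length at most `64 (log (1 - ε) - log ε) / log N` (`window_le`). Since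
`N ≥ n`, Fubini over these lines bounds the measure of the window (`volume_le_of_forall_line`). This
yields order `1 / log n`; the factor `log log n` costs nothing, being bounded below for `n ≥ 3`. -/

namespace GraphThreshold

noncomputable section

/-! ### Expectation, coordinate averages and energies on a product space. -/

section ProductSpace

set_option linter.unusedSectionVars false

variable {ι α : Type*} [Fintype ι] [DecidableEq ι] [Fintype α]

/-- The expectation under the product law whose one-site weights are `m`. -/
def expect (m : α → ℝ) (h : (ι → α) → ℝ) : ℝ := ∑ x, (∏ e, m (x e)) * h x

/-- The average over the coordinate `e`. -/
def avg (m : α → ℝ) (e : ι) (h : (ι → α) → ℝ) (x : ι → α) : ℝ :=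
  ∑ a, m a * h (Function.update x e a)

/-- The change of `h` when the coordinate `e` is switched from `i` to `j`. -/
def flipDiff (i : α) (e : ι) (j : α) (h : (ι → α) → ℝ) (x : ι → α) : ℝ :=
  h (Function.update x e j) - h (Function.update x e i)

/-- The energy of `h` at the coordinate `e`, relative to the base symbol `i`. -/
def siteEnergy (m : α → ℝ) (i : α) (e : ι) (h : (ι → α) → ℝ) : ℝ :=
  ∑ j, expect m fun x => flipDiff i e j h x ^ 2

/-- Exchanging the stored symbol `x e` with the spare symbol `a` is an involution of the pairs. -/
theorem sum_update_swap (Ψ : (ι → α) → α → ℝ) (e : ι) :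
    ∑ x, ∑ a, Ψ x a = ∑ x, ∑ a, Ψ (Function.update x e a) (x e) := by
  rw [← Fintype.sum_prod_type', ← Fintype.sum_prod_type']
  refine Fintype.sum_equiv (Function.Involutive.toPerm
    (fun p : (ι → α) × α => (Function.update p.1 e p.2, p.1 e)) ?_) _ _ ?_
  · rintro ⟨x, a⟩
    simp
  · rintro ⟨x, a⟩
    change Ψ x a = Ψ (Function.update (Function.update x e a) e (x e)) (Function.update x e a e)
    simp

theorem prod_update_erase (m : α → ℝ) (x : ι → α) (e : ι) (a : α) :
    ∏ e' ∈ Finset.univ.erase e, m (Function.update x e a e') =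
      ∏ e' ∈ Finset.univ.erase e, m (x e') :=
  Finset.prod_congr rfl fun e' he' => by
    rw [Function.update_of_ne (Finset.ne_of_mem_erase he')]

/-- Resampling `e` with weights `w` replaces the factor `m (x e)` by `w (x e)`. The weights may be
signed: `w = m` serves averaging, `w = direction i` serves Russo's formula. -/
theorem expect_sum_update {m : α → ℝ} (hm : ∑ a, m a = 1) (w : α → ℝ) (e : ι)
    (h : (ι → α) → ℝ) :
    expect m (fun x => ∑ a, w a * h (Function.update x e a)) =
      ∑ x, (∏ e' ∈ Finset.univ.erase e, m (x e')) * (w (x e) * h x) := by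
  unfold expect
  simp_rw [Finset.mul_sum]
  rw [sum_update_swap _ e]
  refine Finset.sum_congr rfl fun x _ => ?_
  calc ∑ a, (∏ e', m (Function.update x e a e')) *
        (w (x e) * h (Function.update (Function.update x e a) e (x e)))
      = ∑ a, m a * ((∏ e' ∈ Finset.univ.erase e, m (x e')) * (w (x e) * h x)) := by
        refine Finset.sum_congr rfl fun a _ => ?_
        rw [← Finset.mul_prod_erase _ _ (Finset.mem_univ e), prod_update_erase]
        simp [mul_assoc]
    _ = _ := by rw [← Finset.sum_mul, hm, one_mul]

theorem expect_avg {m : α → ℝ} (hm : ∑ a, m a = 1) (e : ι) (h : (ι → α) → ℝ) :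
    expect m (avg m e h) = expect m h := by
  unfold avg
  rw [expect_sum_update hm]
  refine Finset.sum_congr rfl fun x _ => ?_
  rw [← Finset.mul_prod_erase _ _ (Finset.mem_univ e)]
  ring

theorem expect_const {m : α → ℝ} (hm : ∑ a, m a = 1) (c : ℝ) :
    expect m (fun _ : ι → α => c) = c := by
  unfold expect
  have h := Finset.prod_univ_sum (fun _ : ι => Finset.univ) (fun _ a => m a)
  simp only [hm, Finset.prod_const_one, Fintype.piFinset_univ] at h
  rw [← Finset.sum_mul, ← h, one_mul]

theorem expect_mono {m : α → ℝ} (hm : ∀ a, 0 ≤ m a) {g h : (ι → α) → ℝ} (hgh : ∀ x, g x ≤ h x) :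
    expect m g ≤ expect m h :=
  Finset.sum_le_sum fun x _ =>
    mul_le_mul_of_nonneg_left (hgh x) (Finset.prod_nonneg fun _ _ => hm _)

theorem expect_nonneg {m : α → ℝ} (hm : ∀ a, 0 ≤ m a) {h : (ι → α) → ℝ} (hh : ∀ x, 0 ≤ h x) :
    0 ≤ expect m h :=
  Finset.sum_nonneg fun x _ => mul_nonneg (Finset.prod_nonneg fun _ _ => hm _) (hh x)

theorem expect_add (m : α → ℝ) (g h : (ι → α) → ℝ) :
    expect m (fun x => g x + h x) = expect m g + expect m h := by
  simp [expect, mul_add, Finset.sum_add_distrib]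

theorem expect_sub (m : α → ℝ) (g h : (ι → α) → ℝ) :
    expect m (fun x => g x - h x) = expect m g - expect m h := by
  simp [expect, mul_sub, Finset.sum_sub_distrib]

theorem expect_mul_left (m : α → ℝ) (c : ℝ) (h : (ι → α) → ℝ) :
    expect m (fun x => c * h x) = c * expect m h := by
  simp only [expect, Finset.mul_sum]
  exact Finset.sum_congr rfl fun _ _ => by ring

theorem expect_sum (m : α → ℝ) {β : Type*} (s : Finset β) (h : β → (ι → α) → ℝ) :
    expect m (fun x => ∑ b ∈ s, h b x) = ∑ b ∈ s, expect m (h b) := by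
  simp only [expect, Finset.mul_sum]
  exact Finset.sum_comm

theorem avg_update (m : α → ℝ) (e : ι) (h : (ι → α) → ℝ) (x : ι → α) (a : α) :
    avg m e h (Function.update x e a) = avg m e h x := by
  simp [avg]

theorem avg_comm (m : α → ℝ) (e e' : ι) (h : (ι → α) → ℝ) :
    avg m e (avg m e' h) = avg m e' (avg m e h) := by
  rcases eq_or_ne e e' with rfl | hne
  · rfl
  · funext x
    simp only [avg, Finset.mul_sum]
    rw [Finset.sum_comm]
    refine Finset.sum_congr rfl fun a _ => Finset.sum_congr rfl fun b _ => ?_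
    rw [Function.update_comm hne]
    ring

theorem avg_sub (m : α → ℝ) (e : ι) (g h : (ι → α) → ℝ) :
    avg m e (fun x => g x - h x) = fun x => avg m e g x - avg m e h x := by
  funext x
  simp [avg, mul_sub, Finset.sum_sub_distrib]

theorem avg_nonneg {m : α → ℝ} (hm : ∀ a, 0 ≤ m a) (e : ι) {h : (ι → α) → ℝ}
    (hh : ∀ x, 0 ≤ h x) (x : ι → α) : 0 ≤ avg m e h x :=
  Finset.sum_nonneg fun a _ => mul_nonneg (hm a) (hh _)

theorem abs_avg_le {m : α → ℝ} (hm : ∀ a, 0 ≤ m a) (e : ι) (h : (ι → α) → ℝ) (x : ι → α) :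
    |avg m e h x| ≤ avg m e (fun y => |h y|) x := by
  refine (Finset.abs_sum_le_sum_abs _ _).trans (Finset.sum_le_sum fun a _ => ?_)
  rw [abs_mul, abs_of_nonneg (hm a)]

theorem expect_mul_avg {m : α → ℝ} (hm : ∑ a, m a = 1) (e : ι) (h : (ι → α) → ℝ) :
    expect m (fun x => h x * avg m e h x) = expect m (fun x => avg m e h x ^ 2) := by
  rw [← expect_avg hm e]
  congr 1
  funext x
  unfold avg
  simp only [Function.update_idem, ← mul_assoc]
  rw [← Finset.sum_mul, sq]

theorem expect_sub_avg_sq {m : α → ℝ} (hm : ∑ a, m a = 1) (e : ι) (h : (ι → α) → ℝ) :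
    expect m (fun x => (h x - avg m e h x) ^ 2) =
      expect m (fun x => h x ^ 2) - expect m (fun x => avg m e h x ^ 2) := by
  have h1 : (fun x => (h x - avg m e h x) ^ 2) =
      fun x => (h x ^ 2 - 2 * (h x * avg m e h x)) + avg m e h x ^ 2 := by
    funext x
    ring
  rw [h1, expect_add, expect_sub, expect_mul_left, expect_mul_avg hm]
  ring

theorem flipDiff_avg_self (m : α → ℝ) (i : α) (e : ι) (j : α) (h : (ι → α) → ℝ) :
    flipDiff i e j (avg m e h) = fun _ => 0 := by
  funext x
  simp [flipDiff, avg_update]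

theorem flipDiff_avg_of_ne (m : α → ℝ) (i : α) {e e' : ι} (hne : e ≠ e') (j : α)
    (h : (ι → α) → ℝ) : flipDiff i e j (avg m e' h) = avg m e' (flipDiff i e j h) := by
  funext x
  simp only [flipDiff, avg, mul_sub, Finset.sum_sub_distrib]
  simp only [Function.update_comm hne]

theorem flipDiff_sub (i : α) (e : ι) (j : α) (g h : (ι → α) → ℝ) :
    flipDiff i e j (fun x => g x - h x) =
      fun x => flipDiff i e j g x - flipDiff i e j h x := by
  funext x
  simp only [flipDiff]
  ring

/-- For `e ≠ e'` the flip commutes with the average, an orthogonal projection, so Pythagoras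
applies; for `e = e'` the flip of the average vanishes. This identity makes the energies of
martingale differences telescope. -/
theorem siteEnergy_sub_avg {m : α → ℝ} (hm : ∑ a, m a = 1) (i : α) (e e' : ι)
    (h : (ι → α) → ℝ) :
    siteEnergy m i e (fun x => h x - avg m e' h x) =
      siteEnergy m i e h - siteEnergy m i e (avg m e' h) := by
  unfold siteEnergy
  rw [← Finset.sum_sub_distrib]
  refine Finset.sum_congr rfl fun j _ => ?_
  rw [flipDiff_sub]
  rcases eq_or_ne e e' with rfl | hne
  · simp [flipDiff_avg_self, expect]
  · rw [flipDiff_avg_of_ne m i hne, expect_sub_avg_sq hm]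

theorem siteEnergy_nonneg {m : α → ℝ} (hm : ∀ a, 0 ≤ m a) (i : α) (e : ι)
    (h : (ι → α) → ℝ) : 0 ≤ siteEnergy m i e h :=
  Finset.sum_nonneg fun _ _ => expect_nonneg hm fun _ => sq_nonneg _

/-- The average over the coordinates of a list. -/
def avgList (m : α → ℝ) : List ι → ((ι → α) → ℝ) → (ι → α) → ℝ
  | [], h => h
  | e :: l, h => avgList m l (avg m e h)

theorem expect_avgList {m : α → ℝ} (hm : ∑ a, m a = 1) (l : List ι) (h : (ι → α) → ℝ) :
    expect m (avgList m l h) = expect m h := by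
  induction l generalizing h with
  | nil => rfl
  | cons e l ih => rw [avgList, ih, expect_avg hm]

theorem avgList_update_of_forall (m : α → ℝ) (l : List ι) (e : ι) (h : (ι → α) → ℝ)
    (hh : ∀ x a, h (Function.update x e a) = h x) (x : ι → α) (a : α) :
    avgList m l h (Function.update x e a) = avgList m l h x := by
  induction l generalizing h with
  | nil => exact hh x a
  | cons e' l ih =>
    refine ih _ fun x a => ?_
    rcases eq_or_ne e e' with rfl | hne
    · exact avg_update ..
    · simp only [avg]
      refine Finset.sum_congr rfl fun b _ => ?_
      rw [Function.update_comm hne, hh]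

theorem avgList_update (m : α → ℝ) (l : List ι) {e : ι} (he : e ∈ l) (h : (ι → α) → ℝ)
    (x : ι → α) (a : α) : avgList m l h (Function.update x e a) = avgList m l h x := by
  induction l generalizing h with
  | nil => simp at he
  | cons e' l ih =>
    rcases List.mem_cons.1 he with rfl | he
    · exact avgList_update_of_forall m l _ _ (avg_update m _ h) x a
    · exact ih he _

theorem eq_of_update_eq (h : (ι → α) → ℝ)
    (hh : ∀ e x a, h (Function.update x e a) = h x) (x y : ι → α) : h x = h y := by
  have key : ∀ s : Finset ι, h (s.piecewise x y) = h y := by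
    intro s
    induction s using Finset.induction_on with
    | empty => simp
    | insert e s _ ih => rw [Finset.piecewise_insert, hh, ih]
  simpa using key Finset.univ

theorem avgList_eq_expect {m : α → ℝ} (hm : ∑ a, m a = 1) (l : List ι) (hl : ∀ e, e ∈ l)
    (h : (ι → α) → ℝ) : avgList m l h = fun _ => expect m h := by
  funext y
  rw [← expect_avgList hm l h]
  have : avgList m l h = fun _ => avgList m l h y := by
    funext x
    exact eq_of_update_eq _ (fun e x a => avgList_update m l (hl e) h x a) x y
  rw [this, expect_const hm]

/-! ### Logarithmic Sobolev inequality and tensorization. -/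

/-- A uniform logarithmic Sobolev inequality on a finite probability space. -/
theorem entropy_sq_le {m : α → ℝ} (hm0 : ∀ a, 0 ≤ m a) (hm : ∑ a, m a = 1) (i : α) (h : α → ℝ)
    (hh : ∀ a, 0 ≤ h a) :
    ∑ a, m a * (h a ^ 2 * Real.log (h a ^ 2)) -
        (∑ a, m a * h a ^ 2) * Real.log (∑ a, m a * h a ^ 2) ≤
      16 * ∑ j, (h j - h i) ^ 2 := by
  set S := ∑ j, (h j - h i) ^ 2 with hS
  have hS0 : 0 ≤ S := Finset.sum_nonneg fun _ _ => sq_nonneg _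
  set δ := Real.sqrt S with hδ
  have hδ0 : 0 ≤ δ := Real.sqrt_nonneg _
  have hδS : δ ^ 2 = S := Real.sq_sqrt hS0
  have hj : ∀ j, |h j - h i| ≤ δ := fun j => Real.abs_le_sqrt
    (Finset.single_le_sum (f := fun j => (h j - h i) ^ 2) (fun _ _ => sq_nonneg _)
      (Finset.mem_univ j))
  rcases (add_nonneg (hh i) hδ0).eq_or_lt with h0 | hpos
  · have hi0 : h i = 0 := le_antisymm (by linarith) (hh i)
    have hd0 : δ = 0 := by linarith
    have hz : ∀ j, h j = 0 := fun j => by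
      have := hj j
      rw [hd0, hi0, sub_zero] at this
      exact abs_eq_zero.1 (le_antisymm this (abs_nonneg _))
    simp [hz, hS0]
  -- The entropy is at most the mean of `u log (u / c) - u + c` for any reference `c > 0`, hence at
  -- most the mean of `(u - c) ^ 2 / c`. Since `r` dominates all values of `h` and is within `2 * δ`
  -- of each, `c = r ^ 2` gives the factor 16.
  set r := h i + δ
  set c := r ^ 2 with hc
  have hc0 : 0 < c := by positivity
  set U := ∑ a, m a * h a ^ 2 with hU
  have hU0 : 0 ≤ U := Finset.sum_nonneg fun a _ => mul_nonneg (hm0 a) (sq_nonneg _)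
  have hUc : U * Real.log c + U - c ≤ U * Real.log U := by
    rcases hU0.eq_or_lt with h0 | h0
    · rw [← h0]; simp [hc0.le]
    · have := Real.log_le_sub_one_of_pos (div_pos hc0 h0)
      rw [Real.log_div hc0.ne' h0.ne'] at this
      have h2 := mul_le_mul_of_nonneg_left this h0.le
      have h3 : U * (c / U - 1) = c - U := by field_simp
      nlinarith
  have hpt : ∀ a, h a ^ 2 * Real.log (h a ^ 2) ≤ h a ^ 2 * (Real.log c + 1) - c + 16 * S := by
    intro a
    set u := h a ^ 2 with hu
    have h1 : u * Real.log u ≤ u * Real.log c + u * (u / c - 1) := by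
      rcases (sq_nonneg (h a)).eq_or_lt with h0 | h0
      · rw [hu, ← h0]; simp
      · have := Real.log_le_sub_one_of_pos (div_pos h0 hc0)
        rw [Real.log_div h0.ne' hc0.ne'] at this
        have h2 := mul_le_mul_of_nonneg_left this h0.le
        linarith [h2]
    have h2 : u * (u / c - 1) = u - c + (u - c) ^ 2 / c := by
      field_simp
      ring
    have h3 : (u - c) ^ 2 / c ≤ 16 * S := by
      rw [div_le_iff₀ hc0, ← hδS, hc, hu]
      have e1 : (h a ^ 2 - r ^ 2) ^ 2 = (h a - r) ^ 2 * (h a + r) ^ 2 := by ring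
      obtain ⟨l1, l2⟩ := abs_le.1 (hj a)
      have e2 : (h a - r) ^ 2 ≤ (2 * δ) ^ 2 := sq_le_sq' (by simp only [r]; linarith)
        (by simp only [r]; linarith)
      have e3 : (h a + r) ^ 2 ≤ (2 * r) ^ 2 :=
        pow_le_pow_left₀ (add_nonneg (hh a) hpos.le) (by simp only [r]; linarith) 2
      calc (h a ^ 2 - r ^ 2) ^ 2 = (h a - r) ^ 2 * (h a + r) ^ 2 := e1
        _ ≤ (2 * δ) ^ 2 * (2 * r) ^ 2 := mul_le_mul e2 e3 (sq_nonneg _) (sq_nonneg _)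
        _ = 16 * δ ^ 2 * r ^ 2 := by ring
    linarith
  have hsum : ∑ a, m a * (h a ^ 2 * Real.log (h a ^ 2)) ≤ U * (Real.log c + 1) - c + 16 * S := by
    calc ∑ a, m a * (h a ^ 2 * Real.log (h a ^ 2))
        ≤ ∑ a, m a * (h a ^ 2 * (Real.log c + 1) - c + 16 * S) :=
          Finset.sum_le_sum fun a _ => mul_le_mul_of_nonneg_left (hpt a) (hm0 a)
      _ = ∑ a, (m a * h a ^ 2 * (Real.log c + 1) + m a * (16 * S - c)) :=
          Finset.sum_congr rfl fun a _ => by ring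
      _ = _ := by
          rw [Finset.sum_add_distrib, ← Finset.sum_mul, ← Finset.sum_mul, hm]
          ring
  linarith

/-- The reverse triangle inequality in `ℓ²(m)` for `√u` and `√v`. -/
theorem sq_sqrt_sub_sqrt_le {m : α → ℝ} (hm : ∀ a, 0 ≤ m a) {u v : α → ℝ} (hu : ∀ a, 0 ≤ u a)
    (hv : ∀ a, 0 ≤ v a) :
    (√(∑ a, m a * u a) - √(∑ a, m a * v a)) ^ 2 ≤ ∑ a, m a * (√(u a) - √(v a)) ^ 2 := by
  have hU : 0 ≤ ∑ a, m a * u a := Finset.sum_nonneg fun a _ => mul_nonneg (hm a) (hu a)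
  have hV : 0 ≤ ∑ a, m a * v a := Finset.sum_nonneg fun a _ => mul_nonneg (hm a) (hv a)
  have hcs := Real.sum_sqrt_mul_sqrt_le Finset.univ (fun a => mul_nonneg (hm a) (hu a))
    (fun a => mul_nonneg (hm a) (hv a))
  have h1 : ∑ a, m a * (√(u a) - √(v a)) ^ 2 =
      ∑ a, m a * u a + ∑ a, m a * v a - 2 * ∑ a, √(m a * u a) * √(m a * v a) := by
    rw [Finset.mul_sum, ← Finset.sum_add_distrib, ← Finset.sum_sub_distrib]
    refine Finset.sum_congr rfl fun a _ => ?_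
    have e1 : √(m a * u a) * √(m a * v a) = m a * (√(u a) * √(v a)) := by
      rw [Real.sqrt_mul (hm a), Real.sqrt_mul (hm a)]
      calc _ = (√(m a) * √(m a)) * (√(u a) * √(v a)) := by ring
        _ = _ := by rw [Real.mul_self_sqrt (hm a)]
    rw [e1, sub_sq, Real.sq_sqrt (hu a), Real.sq_sqrt (hv a)]
    ring
  rw [h1, sub_sq, Real.sq_sqrt hU, Real.sq_sqrt hV]
  linarith

theorem siteEnergy_sqrt_avg_le {m : α → ℝ} (hm0 : ∀ a, 0 ≤ m a) (hm : ∑ a, m a = 1) (i : α)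
    (e e' : ι) {u : (ι → α) → ℝ} (hu : ∀ x, 0 ≤ u x) :
    siteEnergy m i e (fun x => √(avg m e' u x)) ≤ siteEnergy m i e (fun x => √(u x)) := by
  refine Finset.sum_le_sum fun j _ => ?_
  rcases eq_or_ne e e' with rfl | hne
  · refine expect_mono hm0 fun x => ?_
    simp only [flipDiff, avg_update, sub_self]
    nlinarith [sq_nonneg (√(u (Function.update x e j)) - √(u (Function.update x e i)))]
  · rw [← expect_avg hm e' (fun x => flipDiff i e j (fun x => √(u x)) x ^ 2)]
    refine expect_mono hm0 fun x => ?_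
    simp only [flipDiff, avg, Function.update_comm hne]
    exact sq_sqrt_sub_sqrt_le hm0 (fun _ => hu _) (fun _ => hu _)

/-- Averaging over one coordinate loses the mean of the one-site entropies, which `entropy_sq_le`
bounds. Later losses involve square roots of averages, whose energies do not exceed the original
ones. -/
theorem expect_entropy_avgList_le {m : α → ℝ} (hm0 : ∀ a, 0 ≤ m a) (hm : ∑ a, m a = 1) (i : α)
    (l : List ι) (u : (ι → α) → ℝ) (hu : ∀ x, 0 ≤ u x) :
    expect m (fun x => u x * Real.log (u x)) -
        expect m (fun x => avgList m l u x * Real.log (avgList m l u x)) ≤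
      16 * (l.map fun e => siteEnergy m i e fun x => √(u x)).sum := by
  induction l generalizing u with
  | nil => simp [avgList]
  | cons e l ih =>
    have h1 := ih (avg m e u) (avg_nonneg hm0 e hu)
    have h2 : (l.map fun e' => siteEnergy m i e' fun x => √(avg m e u x)).sum ≤
        (l.map fun e => siteEnergy m i e fun x => √(u x)).sum :=
      List.sum_le_sum fun e' _ => siteEnergy_sqrt_avg_le hm0 hm i e' e hu
    have h3 : expect m (fun x => u x * Real.log (u x)) -
        expect m (fun x => avg m e u x * Real.log (avg m e u x)) ≤
        16 * siteEnergy m i e fun x => √(u x) := by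
      rw [← expect_avg hm e (fun x => u x * Real.log (u x)), ← expect_sub]
      unfold siteEnergy
      rw [← expect_sum, ← expect_mul_left]
      refine expect_mono hm0 fun x => ?_
      have := entropy_sq_le hm0 hm i (fun a => √(u (Function.update x e a)))
        fun _ => Real.sqrt_nonneg _
      simpa only [avg, flipDiff, Real.sq_sqrt (hu _)] using this
    simp only [avgList, List.map_cons, List.sum_cons]
    linarith

/-- The uniform logarithmic Sobolev inequality for product laws. -/
theorem entropy_le_energy {m : α → ℝ} (hm0 : ∀ a, 0 ≤ m a) (hm : ∑ a, m a = 1) (i : α)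
    (g : (ι → α) → ℝ) :
    expect m (fun x => g x ^ 2 * Real.log (g x ^ 2)) -
        expect m (fun x => g x ^ 2) * Real.log (expect m fun x => g x ^ 2) ≤
      16 * ∑ e, siteEnergy m i e g := by
  have h1 := expect_entropy_avgList_le hm0 hm i Finset.univ.toList (fun x : ι → α => g x ^ 2)
    fun _ => sq_nonneg _
  rw [avgList_eq_expect hm _ (by simp), expect_const hm, Finset.sum_map_toList] at h1
  refine h1.trans (mul_le_mul_of_nonneg_left (Finset.sum_le_sum fun e _ =>
    Finset.sum_le_sum fun j _ => expect_mono hm0 fun x => ?_) (by norm_num))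
  simp only [flipDiff, Real.sqrt_sq_eq_abs]
  exact sq_le_sq.2 (abs_abs_sub_abs_le_abs_sub _ _)

/-! ### Variance against energy through martingale differences. -/

/-- Integrates `log (a / |g|) ≤ a / |g| - 1` against `g ^ 2`, with a free scale `a`: a function
whose first and second moments are both small has large entropy relative to its second moment. -/
theorem le_entropy {m : α → ℝ} (hm0 : ∀ a, 0 ≤ m a) (g : (ι → α) → ℝ) {a b : ℝ} (ha : 0 < a)
    (hb : expect m (fun x => g x ^ 2) ≤ b) :
    (2 + 2 * Real.log a - Real.log b) * expect m (fun x => g x ^ 2) -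
        2 * a * expect m (fun x => |g x|) ≤
      expect m (fun x => g x ^ 2 * Real.log (g x ^ 2)) -
        expect m (fun x => g x ^ 2) * Real.log (expect m fun x => g x ^ 2) := by
  have h1 : (2 + 2 * Real.log a) * expect m (fun x => g x ^ 2) -
      2 * a * expect m (fun x => |g x|) ≤ expect m (fun x => g x ^ 2 * Real.log (g x ^ 2)) := by
    rw [← expect_mul_left, ← expect_mul_left, ← expect_sub]
    refine expect_mono hm0 fun x => ?_
    rw [← sq_abs (g x)]
    set u := |g x|
    rcases (abs_nonneg (g x)).eq_or_lt with h0 | h0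
    · simp only [u, ← h0]; simp
    · have := Real.log_le_sub_one_of_pos (div_pos ha h0)
      rw [Real.log_div ha.ne' h0.ne'] at this
      rw [Real.log_pow]
      have h2 := mul_le_mul_of_nonneg_left this (sq_nonneg u)
      have h3 : u ^ 2 * (a / u - 1) = a * u - u ^ 2 := by
        have : u ≠ 0 := h0.ne'
        field_simp
      push_cast
      linarith
  have h2 : expect m (fun x => g x ^ 2) * Real.log (expect m fun x => g x ^ 2) ≤
      expect m (fun x => g x ^ 2) * Real.log b := by
    rcases (expect_nonneg hm0 fun x => sq_nonneg (g x)).eq_or_lt with h0 | h0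
    · rw [← h0]; simp
    · exact mul_le_mul_of_nonneg_left (Real.log_le_log h0 hb) h0.le
  linarith

theorem sub_avg_avg (m : α → ℝ) (e e' : ι) (h : (ι → α) → ℝ) :
    (fun x => avg m e' h x - avg m e (avg m e' h) x) =
      avg m e' (fun x => h x - avg m e h x) := by
  rw [avg_comm, avg_sub]

theorem sq_avg_le {m : α → ℝ} (hm0 : ∀ a, 0 ≤ m a) (hm : ∑ a, m a = 1) (e : ι)
    (h : (ι → α) → ℝ) : expect m (fun x => avg m e h x ^ 2) ≤ expect m (fun x => h x ^ 2) := by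
  have h1 := expect_sub_avg_sq hm e h
  have h2 := expect_nonneg hm0 fun x => sq_nonneg (h x - avg m e h x)
  linarith

/-- Each step compares the lower entropy bound with the logarithmic Sobolev inequality for `h - avg
m e h`. Averages contract both norms, so the moment bounds persist along the list. -/
theorem variance_le_energy_avgList {m : α → ℝ} (hm0 : ∀ a, 0 ≤ m a) (hm : ∑ a, m a = 1) (i : α)
    {a b : ℝ} (ha : 0 < a) (l : List ι) (h : (ι → α) → ℝ)
    (h1 : ∀ e, expect m (fun x => |h x - avg m e h x|) ≤ b)
    (h2 : ∀ e, expect m (fun x => (h x - avg m e h x) ^ 2) ≤ b) :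
    (2 + 2 * Real.log a - Real.log b) *
        (expect m (fun x => h x ^ 2) - expect m (fun x => avgList m l h x ^ 2)) -
        2 * a * b * l.length ≤
      16 * (∑ e, siteEnergy m i e h) := by
  -- The energy left after averaging is kept, so that the induction telescopes.
  suffices H : (2 + 2 * Real.log a - Real.log b) *
        (expect m (fun x => h x ^ 2) - expect m (fun x => avgList m l h x ^ 2)) -
        2 * a * b * l.length ≤
      16 * (∑ e, siteEnergy m i e h - ∑ e, siteEnergy m i e (avgList m l h)) by
    have := Finset.sum_nonneg fun e (_ : e ∈ Finset.univ) =>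
      siteEnergy_nonneg hm0 i e (avgList m l h)
    linarith
  induction l generalizing h with
  | nil => simp [avgList]
  | cons e l ih =>
    have h3 := ih (avg m e h) (fun e' => by
      have e1 : (fun x => |avg m e h x - avg m e' (avg m e h) x|) =
          fun x => |avg m e (fun x => h x - avg m e' h x) x| := by
        funext x
        rw [← sub_avg_avg]
      rw [e1]
      refine le_trans ?_ (h1 e')
      rw [← expect_avg hm e (fun x => |h x - avg m e' h x|)]
      exact expect_mono hm0 fun x => abs_avg_le hm0 _ _ _) (fun e' => by
      have := sq_avg_le hm0 hm e (fun x => h x - avg m e' h x)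
      rw [← sub_avg_avg] at this
      exact this.trans (h2 e'))
    have h4 := (le_entropy hm0 (fun x => h x - avg m e h x) ha (h2 e)).trans
      (entropy_le_energy hm0 hm i _)
    have h5 := mul_le_mul_of_nonneg_left (h1 e) (by positivity : 0 ≤ 2 * a)
    rw [expect_sub_avg_sq hm] at h4
    simp only [siteEnergy_sub_avg hm, Finset.sum_sub_distrib] at h4
    simp only [avgList, List.length_cons]
    push_cast
    linarith

end ProductSpace

/-! ### Equal site energies, Russo's formula and the window on a line. -/

section Russo

set_option linter.unusedSectionVars false

variable {ι α : Type*} [Fintype ι] [DecidableEq ι] [Fintype α]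

theorem le_one_of_sum_eq_one {m : α → ℝ} (hm0 : ∀ a, 0 ≤ m a) (hm : ∑ a, m a = 1) (a : α) :
    m a ≤ 1 :=
  hm ▸ Finset.single_le_sum (fun b _ => hm0 b) (Finset.mem_univ a)

theorem flipDiff_sq_eq_abs {f : (ι → α) → ℝ} (hf : ∀ x, f x = 0 ∨ f x = 1) (i : α) (e : ι) (j : α)
    (x : ι → α) : flipDiff i e j f x ^ 2 = |flipDiff i e j f x| := by
  unfold flipDiff
  rcases hf (Function.update x e j) with h | h <;> rcases hf (Function.update x e i) with h' | h' <;>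
  simp [h, h']

/-- With the other coordinates fixed, both `f` and its average are compared with the value of `f` at
the base symbol `i`; each comparison costs one energy because the weights are at most 1. -/
theorem expect_abs_sub_avg_le {m : α → ℝ} (hm0 : ∀ a, 0 ≤ m a) (hm : ∑ a, m a = 1)
    {f : (ι → α) → ℝ} (hf : ∀ x, f x = 0 ∨ f x = 1) (i : α) (e : ι) :
    expect m (fun x => |f x - avg m e f x|) ≤ 2 * siteEnergy m i e f := by
  unfold siteEnergy
  rw [← expect_sum, ← expect_mul_left, ← expect_avg hm e]
  refine expect_mono hm0 fun x => ?_
  simp only [flipDiff_sq_eq_abs hf]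
  set s := ∑ b, |flipDiff i e b f x| with hs
  set A := avg m e f x
  have h1 : ∑ b, m b * |flipDiff i e b f x| ≤ s := Finset.sum_le_sum fun b _ =>
    mul_le_of_le_one_left (abs_nonneg _) (le_one_of_sum_eq_one hm0 hm b)
  have h2 : |f (Function.update x e i) - A| ≤ s := by
    have : A - f (Function.update x e i) = ∑ b, m b * flipDiff i e b f x := by
      simp only [flipDiff, mul_sub, Finset.sum_sub_distrib, ← Finset.sum_mul, hm, one_mul]
      rfl
    rw [abs_sub_comm, this]
    refine le_trans ((Finset.abs_sum_le_sum_abs _ _).trans (Finset.sum_le_sum fun b _ => ?_)) h1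
    rw [abs_mul, abs_of_nonneg (hm0 b)]
  calc avg m e (fun x => |f x - avg m e f x|) x
      = ∑ a, m a * |f (Function.update x e a) - A| := by
        simp only [avg, Function.update_idem]
        rfl
    _ ≤ ∑ a, m a * (|flipDiff i e a f x| + s) :=
        Finset.sum_le_sum fun a _ => mul_le_mul_of_nonneg_left
          ((abs_sub_le _ (f (Function.update x e i)) _).trans (add_le_add le_rfl h2)) (hm0 a)
    _ = ∑ a, m a * |flipDiff i e a f x| + s := by
        simp only [mul_add, Finset.sum_add_distrib, ← Finset.sum_mul, hm, one_mul]
    _ ≤ 2 * s := by linarith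

theorem expect_sub_avg_sq_le {m : α → ℝ} (hm0 : ∀ a, 0 ≤ m a) (hm : ∑ a, m a = 1)
    {f : (ι → α) → ℝ} (hf : ∀ x, f x = 0 ∨ f x = 1) (e : ι) :
    expect m (fun x => (f x - avg m e f x) ^ 2) ≤ expect m (fun x => |f x - avg m e f x|) := by
  have h01 : ∀ x, 0 ≤ f x ∧ f x ≤ 1 := fun x => by rcases hf x with h | h <;> simp [h]
  refine expect_mono hm0 fun x => ?_
  have h1 : 0 ≤ avg m e f x := avg_nonneg hm0 e (fun x => (h01 x).1) x
  have h2 : avg m e f x ≤ 1 := by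
    rw [← hm]
    exact Finset.sum_le_sum fun a _ => mul_le_of_le_one_right (hm0 a) (h01 _).2
  have h3 : |f x - avg m e f x| ≤ 1 := abs_le.2 ⟨by linarith [h01 x], by linarith [h01 x]⟩
  rw [← sq_abs]
  nlinarith [abs_nonneg (f x - avg m e f x)]

/-- If all the sites have the same energy, then the total energy of an indicator function exceeds
its variance by a factor of the order of the logarithm of the number of the sites. -/
theorem variance_mul_log_le_energy {m : α → ℝ} (hm0 : ∀ a, 0 ≤ m a) (hm : ∑ a, m a = 1)
    {f : (ι → α) → ℝ} (hf : ∀ x, f x = 0 ∨ f x = 1) (i : α)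
    (hI : ∀ e e', siteEnergy m i e f = siteEnergy m i e' f) :
    Real.log (Fintype.card ι) / 32 * (expect m f * (1 - expect m f)) ≤
      ∑ e, siteEnergy m i e f := by
  set D := ∑ e, siteEnergy m i e f with hD
  set V := expect m f * (1 - expect m f) with hV
  set N : ℝ := (Fintype.card ι : ℝ) with hN
  have hD0 : 0 ≤ D := Finset.sum_nonneg fun e _ => siteEnergy_nonneg hm0 i e f
  -- The negation bounds the energy of each site by `D' / N`, which supplies the small moments.
  by_contra! hlt
  set D' := Real.log N / 32 * V with hD'
  have hD'0 : 0 < D' := hD0.trans_lt hlt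
  have hV4 : V ≤ 1 / 4 := by nlinarith [sq_nonneg (expect m f - 1 / 2)]
  have hN0 : 0 ≤ Real.log N := Real.log_natCast_nonneg _
  have hlog : 0 < Real.log N := hN0.lt_of_ne fun h => by simp [hD', ← h] at hD'0
  have hV0 : 0 < V := by
    by_contra! h
    exact absurd hD'0 (not_lt.2 (mul_nonpos_of_nonneg_of_nonpos (by positivity) h))
  have hNpos : 0 < N := by
    rcases (Nat.cast_nonneg (α := ℝ) (Fintype.card ι)).eq_or_lt with h | h
    · rw [hN, ← h] at hlog
      simp at hlog
    · exact h
  have hsite : ∀ e, N * siteEnergy m i e f = D := fun e => by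
    rw [hD, Finset.sum_congr rfl fun e' _ => hI e' e]
    simp [hN]
  -- This scale gives `2 * a * b * N = 2 * V`, cancelling the term `2 * V` in `key`.
  set a := V / (2 * D') with ha
  set b := 2 * D' / N with hb
  have h1 : ∀ e, expect m (fun x => |f x - avg m e f x|) ≤ b := fun e => by
    refine (expect_abs_sub_avg_le hm0 hm hf i e).trans ?_
    rw [hb, le_div_iff₀ hNpos]
    linarith [hsite e]
  have key := variance_le_energy_avgList hm0 hm i (a := a) (b := b) (by positivity)
    Finset.univ.toList f h1 fun e => (expect_sub_avg_sq_le hm0 hm hf e).trans (h1 e)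
  have hff : (fun x => f x ^ 2) = f := by
    funext x
    rcases hf x with h | h <;> simp [h]
  rw [avgList_eq_expect hm _ (by simp), expect_const hm, hff, Finset.length_toList,
    Finset.card_univ] at key
  have hV' : expect m f - expect m f ^ 2 = V := by rw [hV]; ring
  have hab : 2 * a * b * N = 2 * V := by
    rw [ha, hb]
    field_simp
  rw [hV', hab] at key
  have e1 : Real.log a = Real.log V - (Real.log 2 + Real.log D') := by
    rw [ha, Real.log_div hV0.ne' (by positivity), Real.log_mul two_ne_zero hD'0.ne']
  have e2 : Real.log b = Real.log 2 + Real.log D' - Real.log N := by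
    rw [hb, Real.log_div (by positivity) hNpos.ne', Real.log_mul two_ne_zero hD'0.ne']
  have e3 : Real.log D' = Real.log (Real.log N) - Real.log 32 + Real.log V := by
    rw [hD', Real.log_mul (by positivity) hV0.ne', Real.log_div hlog.ne' (by norm_num)]
  have e4 : Real.log V ≤ 0 := Real.log_nonpos hV0.le (by linarith)
  -- `2 log a - log b` contains `-3 log log N`; with the slope 1/6 this consumes only half of `log
  -- N`.
  have e5 : Real.log (Real.log N) ≤ Real.log 6 + (Real.log N / 6 - 1) := by
    have := Real.log_le_sub_one_of_pos (div_pos hlog (by norm_num : (0 : ℝ) < 6))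
    rw [Real.log_div hlog.ne' (by norm_num)] at this
    linarith
  have e6 : Real.log 6 + Real.log 2 ≤ Real.log 32 := by
    rw [← Real.log_mul (by norm_num) (by norm_num)]
    exact Real.log_le_log (by norm_num) (by norm_num)
  have e7 : Real.log N / 2 * V ≤ (2 * Real.log a - Real.log b) * V :=
    mul_le_mul_of_nonneg_right (by linarith) hV0.le
  have e8 : 16 * D' = Real.log N / 2 * V := by rw [hD']; ring
  linarith

variable [DecidableEq α]

/-- The direction in which the weight of `i` grows at the expense of all the other weights. -/
def direction (i : α) (a : α) : ℝ := (if a = i then (Fintype.card α : ℝ) else 0) - 1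

theorem sum_direction (i : α) : ∑ a, direction i a = 0 := by
  simp [direction]

/-- Monotonicity fixes the sign of every flip, and a difference of indicator values is its own
square up to sign. Thus the derivative is exactly the energy. -/
theorem sum_direction_mul {f : (ι → α) → ℝ} (hf : ∀ x, f x = 0 ∨ f x = 1) (i : α)
    (hmono : ∀ x e j, f (Function.update x e j) ≤ f (Function.update x e i)) (e : ι) (x : ι → α) :
    ∑ a, direction i a * f (Function.update x e a) = ∑ j, flipDiff i e j f x ^ 2 := by
  have : ∀ j, flipDiff i e j f x ^ 2 = f (Function.update x e i) - f (Function.update x e j) := by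
    intro j
    rw [flipDiff_sq_eq_abs hf, flipDiff, abs_of_nonpos (sub_nonpos.2 (hmono x e j)), neg_sub]
  simp [this, direction, sub_mul]

/-- A version of Russo's formula. -/
theorem hasDerivAt_expect {f : (ι → α) → ℝ} (hf : ∀ x, f x = 0 ∨ f x = 1) (i : α)
    (hmono : ∀ x e j, f (Function.update x e j) ≤ f (Function.update x e i))
    {m : α → ℝ} (hm : ∑ a, m a = 1) (t : ℝ) :
    HasDerivAt (fun t : ℝ => expect (fun a => m a + t * direction i a) f)
      (∑ e, siteEnergy (fun a => m a + t * direction i a) i e f) t := by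
  have hsum : ∑ a, (m a + t * direction i a) = 1 := by
    rw [Finset.sum_add_distrib, ← Finset.mul_sum, sum_direction, hm]
    ring
  have h1 : ∀ a, HasDerivAt (fun t : ℝ => m a + t * direction i a) (direction i a) t := fun a => by
    simpa using ((hasDerivAt_id t).mul_const (direction i a)).const_add (m a)
  have h2 : HasDerivAt (fun t : ℝ => expect (fun a => m a + t * direction i a) f)
      (∑ x, (∑ e, (∏ e' ∈ Finset.univ.erase e, (m (x e') + t * direction i (x e'))) •
        direction i (x e)) * f x) t := by
    unfold expect
    exact HasDerivAt.fun_sum fun x _ =>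
      (HasDerivAt.fun_finsetProd fun e _ => h1 (x e)).mul_const (f x)
  convert h2 using 1
  simp only [Finset.sum_mul]
  rw [Finset.sum_comm]
  refine Finset.sum_congr rfl fun e _ => ?_
  unfold siteEnergy
  rw [← expect_sum]
  simp only [← sum_direction_mul hf i hmono]
  rw [expect_sum_update hsum]
  exact Finset.sum_congr rfl fun x _ => by rw [smul_eq_mul, mul_assoc]

/-- On a line in the direction `direction i`, the threshold window is short. -/
theorem window_le {f : (ι → α) → ℝ} (hf : ∀ x, f x = 0 ∨ f x = 1) (i : α)
    (hmono : ∀ x e j, f (Function.update x e j) ≤ f (Function.update x e i))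
    (hI : ∀ m e e', siteEnergy m i e f = siteEnergy m i e' f)
    {m : α → ℝ} (hm : ∑ a, m a = 1) {s t ε : ℝ} (hst : s ≤ t) (hε : 0 < ε)
    (hs0 : ∀ a, 0 ≤ m a + s * direction i a) (ht0 : ∀ a, 0 ≤ m a + t * direction i a)
    (hs : ε ≤ expect (fun a => m a + s * direction i a) f)
    (ht : expect (fun a => m a + t * direction i a) f ≤ 1 - ε) :
    Real.log (Fintype.card ι) / 32 * (t - s) ≤ 2 * (Real.log (1 - ε) - Real.log ε) := by
  set F : ℝ → ℝ := fun r => expect (fun a => m a + r * direction i a) f with hF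
  have hnn : ∀ r ∈ Set.Icc s t, ∀ a, 0 ≤ m a + r * direction i a := by
    intro r hr a
    rcases le_total 0 (direction i a) with h | h
    · exact (hs0 a).trans (add_le_add le_rfl (mul_le_mul_of_nonneg_right hr.1 h))
    · exact (ht0 a).trans (add_le_add le_rfl (mul_le_mul_of_nonpos_right hr.2 h))
  have hsum : ∀ r : ℝ, ∑ a, (m a + r * direction i a) = 1 := fun r => by
    rw [Finset.sum_add_distrib, ← Finset.mul_sum, sum_direction, hm]
    ring
  have hder : ∀ r, HasDerivAt F (∑ e, siteEnergy (fun a => m a + r * direction i a) i e f) r :=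
    hasDerivAt_expect hf i hmono hm
  have hcont : Continuous F := continuous_iff_continuousAt.2 fun r => (hder r).continuousAt
  have hmonoF : MonotoneOn F (Set.Icc s t) := by
    refine monotoneOn_of_deriv_nonneg (convex_Icc s t) hcont.continuousOn
      (fun r _ => (hder r).differentiableAt.differentiableWithinAt) fun r hr => ?_
    rw [(hder r).deriv]
    exact Finset.sum_nonneg fun e _ => siteEnergy_nonneg (hnn r (interior_subset hr)) i e f
  have hFr : ∀ r ∈ Set.Icc s t, ε ≤ F r ∧ F r ≤ 1 - ε := fun r hr =>
    ⟨hs.trans (hmonoF (Set.left_mem_Icc.2 hst) hr hr.1),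
      (hmonoF hr (Set.right_mem_Icc.2 hst) hr.2).trans ht⟩
  -- The derivative of the log-odds is the energy divided by the variance `F r * (1 - F r)`.
  have hlder : ∀ r ∈ Set.Icc s t, HasDerivAt (fun r => Real.log (F r) - Real.log (1 - F r))
      ((∑ e, siteEnergy (fun a => m a + r * direction i a) i e f) / F r -
        -(∑ e, siteEnergy (fun a => m a + r * direction i a) i e f) / (1 - F r)) r := fun r hr =>
    ((hder r).log (by linarith [hFr r hr])).sub
      (((hder r).const_sub 1).log (by linarith [hFr r hr]))
  have key := (convex_Icc s t).mul_sub_le_image_sub_of_le_deriv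
    (f := fun r => Real.log (F r) - Real.log (1 - F r)) (C := Real.log (Fintype.card ι) / 32)
    (fun r hr => (hlder r hr).continuousAt.continuousWithinAt)
    (fun r hr => (hlder r (interior_subset hr)).differentiableAt.differentiableWithinAt)
    (fun r hr => by
      have hr' := interior_subset hr
      rw [(hlder r hr').deriv]
      have h1 : 0 < F r := by linarith [hFr r hr']
      have h2 : 0 < 1 - F r := by linarith [hFr r hr']
      have h3 := variance_mul_log_le_energy (hnn r hr') (hsum r) hf i (hI _)
      have h4 : ∀ D : ℝ, D / F r - -D / (1 - F r) = D / (F r * (1 - F r)) := fun D => by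
        field_simp
        ring
      rw [h4, le_div_iff₀ (mul_pos h1 h2)]
      exact h3)
    s (Set.left_mem_Icc.2 hst) t (Set.right_mem_Icc.2 hst) hst
  have hs' := hFr s (Set.left_mem_Icc.2 hst)
  have ht' := hFr t (Set.right_mem_Icc.2 hst)
  have l1 : Real.log ε ≤ Real.log (F s) := Real.log_le_log hε hs'.1
  have l2 : Real.log (1 - F s) ≤ Real.log (1 - ε) :=
    Real.log_le_log (by linarith) (by linarith)
  have l3 : Real.log (F t) ≤ Real.log (1 - ε) := Real.log_le_log (by linarith) ht'.2
  have l4 : Real.log ε ≤ Real.log (1 - F t) := Real.log_le_log hε (by linarith)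
  linarith

theorem siteEnergy_equiv (m : α → ℝ) (i : α) (τ : ι ≃ ι) {f : (ι → α) → ℝ}
    (hτ : ∀ x, f (x ∘ τ) = f x) (e : ι) : siteEnergy m i (τ e) f = siteEnergy m i e f := by
  unfold siteEnergy expect
  refine Finset.sum_congr rfl fun j _ => ?_
  refine Fintype.sum_equiv (Equiv.arrowCongr τ.symm (Equiv.refl α)) _ _ fun x => ?_
  have h1 : ∀ j, f (Function.update (x ∘ τ) e j) = f (Function.update x (τ e) j) := fun j => by
    rw [← hτ (Function.update x (τ e) j), Function.update_comp_equiv, Equiv.symm_apply_apply]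
  have h2 : (Equiv.arrowCongr τ.symm (Equiv.refl α)) x = x ∘ τ := by
    funext a
    simp
  rw [h2]
  simp only [flipDiff, h1, Function.comp_apply]
  rw [Equiv.prod_comp τ (fun e => m (x e))]

end Russo

/-! ### Edge symmetry and the indicator of a graph property. -/

section Graph

variable {n q : ℕ}

theorem map_mem_edges (σ : Equiv.Perm (Fin n)) {e : Sym2 (Fin n)} (he : e ∈ edges n) :
    Sym2.map σ e ∈ edges n := by
  induction e with
  | _ u v => simpa [edges] using he

/-- The permutation of the edges that is induced by a permutation of the vertices. -/
def edgePerm (σ : Equiv.Perm (Fin n)) : edges n ≃ edges n where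
  toFun e := ⟨Sym2.map σ e, map_mem_edges σ e.2⟩
  invFun e := ⟨Sym2.map σ.symm e, map_mem_edges σ.symm e.2⟩
  left_inv e := by
    ext1
    simp [Sym2.map_map]
  right_inv e := by
    ext1
    simp [Sym2.map_map]

theorem exists_edgePerm_eq (e e' : edges n) : ∃ σ, edgePerm σ e = e' := by
  obtain ⟨e, he⟩ := e
  obtain ⟨e', he'⟩ := e'
  induction e with
  | _ u v =>
    induction e' with
    | _ u' v' =>
      have huv : u ≠ v := by simpa [edges] using he
      have huv' : u' ≠ v' := by simpa [edges] using he'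
      -- The first swap sends `u` to `u'`; the second sends the image of `v` to `v'` and fixes `u'`.
      refine ⟨(Equiv.swap u u').trans (Equiv.swap (Equiv.swap u u' v) v'), Subtype.ext ?_⟩
      have h1 : u' ≠ Equiv.swap u u' v := fun h => huv (by
        have := congrArg (Equiv.swap u u') h
        simpa using this)
      simp [edgePerm, Equiv.swap_apply_of_ne_of_ne h1 huv']

theorem EdgePartition.ext_part {E F : EdgePartition n q} (h : ∀ i, E.part i = F.part i) :
    E = F := by
  cases E
  cases F
  congr
  exact funext h

theorem perm_ofLabeling (σ : Equiv.Perm (Fin n)) (x : edges n → Fin q) :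
    (EdgePartition.ofLabeling (x ∘ edgePerm σ)).perm σ = EdgePartition.ofLabeling x := by
  refine EdgePartition.ext_part fun i => Set.ext fun e => ?_
  constructor
  · rintro ⟨d, ⟨hd, hx⟩, rfl⟩
    exact ⟨map_mem_edges σ hd, hx⟩
  · rintro ⟨he, hx⟩
    have h1 : Sym2.map σ (Sym2.map σ.symm e) = e := by simp [Sym2.map_map]
    refine ⟨Sym2.map σ.symm e, ⟨map_mem_edges σ.symm he, ?_⟩, h1⟩
    simpa [edgePerm, h1] using hx

open Classical in
/-- The indicator function of the labelings to which the property `A` assigns the value `i`. -/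
def indicatorFn (A : EdgePartition n q → Fin q) (i : Fin q) (x : edges n → Fin q) : ℝ :=
  if A (EdgePartition.ofLabeling x) = i then 1 else 0

theorem indicatorFn_eq (A : EdgePartition n q → Fin q) (i : Fin q) (x : edges n → Fin q) :
    indicatorFn A i x = 0 ∨ indicatorFn A i x = 1 := by
  unfold indicatorFn
  split_ifs <;> simp

open Classical in
theorem indicatorFn_update_le {A : EdgePartition n q → Fin q} (hA : IsMonotoneGraphProperty A)
    (i : Fin q) (x : edges n → Fin q) (e : edges n) (j : Fin q) :
    indicatorFn A i (Function.update x e j) ≤ indicatorFn A i (Function.update x e i) := by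
  unfold indicatorFn
  split_ifs with h1 h2
  · exact le_rfl
  · refine absurd (hA.monotone _ _ i ?_ ?_ h1) h2
    · rintro d ⟨hd, hx⟩
      refine ⟨hd, ?_⟩
      rcases eq_or_ne ⟨d, hd⟩ e with rfl | hne
      · simp
      · rwa [Function.update_of_ne hne] at hx ⊢
    · rintro k hk d ⟨hd, hx⟩
      refine ⟨hd, ?_⟩
      rcases eq_or_ne ⟨d, hd⟩ e with rfl | hne
      · exact absurd (by simpa using hx) hk.symm
      · rwa [Function.update_of_ne hne] at hx ⊢
  · exact zero_le_one
  · exact le_rfl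

open Classical in
theorem siteEnergy_indicatorFn_eq {A : EdgePartition n q → Fin q} (hA : IsGraphProperty A)
    (i : Fin q) (m : Fin q → ℝ) (e e' : edges n) :
    siteEnergy m i e (indicatorFn A i) = siteEnergy m i e' (indicatorFn A i) := by
  obtain ⟨σ, rfl⟩ := exists_edgePerm_eq e e'
  refine (siteEnergy_equiv m i (edgePerm σ) (fun x => ?_) e).symm
  unfold indicatorFn
  rw [← perm_ofLabeling σ x, hA]

theorem colorLaw_singleton (μ : Fin q → ℝ) (a : Fin q) :
    colorLaw μ {a} = ENNReal.ofReal (μ a) := by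
  simp [colorLaw, Set.indicator_apply]

instance (μ : Fin q → ℝ) : IsFiniteMeasure (colorLaw μ) := by
  refine ⟨?_⟩
  simp [colorLaw]

theorem labelingLaw_real_singleton {μ : Fin q → ℝ} (hμ : ∀ a, 0 ≤ μ a) (x : edges n → Fin q) :
    (labelingLaw n μ).real {x} = ∏ e, μ (x e) := by
  rw [measureReal_def, labelingLaw, Measure.pi_singleton, ENNReal.toReal_prod]
  exact Finset.prod_congr rfl fun e _ => by
    rw [colorLaw_singleton, ENNReal.toReal_ofReal (hμ _)]

instance (μ : Fin q → ℝ) : IsFiniteMeasure (labelingLaw n μ) :=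
  inferInstanceAs (IsFiniteMeasure (Measure.pi fun _ => colorLaw μ))

open Classical in
theorem prob_eq_expect {μ : Fin q → ℝ} (hμ : ∀ a, 0 ≤ μ a) (A : EdgePartition n q → Fin q)
    (i : Fin q) : prob μ A i = expect μ (indicatorFn A i) := by
  have h1 : {x | A (EdgePartition.ofLabeling x) = i} =
      ((Finset.univ.filter fun x : edges n → Fin q => A (EdgePartition.ofLabeling x) = i :
        Finset (edges n → Fin q)) : Set (edges n → Fin q)) := by
    ext x
    simp
  unfold prob expect
  rw [h1, ← sum_measureReal_singleton, Finset.sum_filter]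
  refine Finset.sum_congr rfl fun x _ => ?_
  rw [labelingLaw_real_singleton hμ]
  unfold indicatorFn
  split_ifs <;> simp

theorem le_card_edges (hn : 3 ≤ n) : n ≤ Fintype.card (edges n) := by
  have h1 : Fintype.card (edges n) = n.choose 2 := by
    have := SimpleGraph.card_edgeFinset_top_eq_card_choose_two (V := Fin n)
    rw [Fintype.card_fin] at this
    rw [← this]
    exact (Fintype.card_congr (Equiv.refl _)).trans SimpleGraph.edgeFinset_card.symm
  rw [h1, Nat.choose_two_right, Nat.le_div_iff_mul_le two_pos]
  exact Nat.mul_le_mul_left n (by omega)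

end Graph

/-! ### Fubini along a direction and coordinates on the simplex. -/

section Geometry

/-- A set that meets every line of a given direction in a set of diameter at most `ℓ` has a volume
of the order of `ℓ`. -/
theorem volume_le_of_forall_line {m : ℕ} (v : Fin m → ℝ) {S B : Set (Fin m → ℝ)} {ℓ : ℝ}
    (hS : MeasurableSet S) (hB : MeasurableSet B)
    (hSB : ∀ y, ∀ t ∈ Set.Icc (0 : ℝ) 1, y + t • v ∈ S → y ∈ B)
    (hline : ∀ y s t, s ≤ t → y + s • v ∈ S → y + t • v ∈ S → t - s ≤ ℓ) :
    volume S ≤ ENNReal.ofReal ℓ * volume B := by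
  have hmeas : Measurable fun p : ℝ × (Fin m → ℝ) => p.2 + p.1 • v := by fun_prop
  -- For `t` in `[0, 1]` the translates of `S` all lie in `B`, so averaging over `t` leaves the
  -- volume of `S` unchanged.
  have h1 : ∀ t ∈ Set.Icc (0 : ℝ) 1,
      ∫⁻ y in B, S.indicator 1 (y + t • v) = volume S := by
    intro t ht
    have e1 : ∫⁻ y in B, S.indicator 1 (y + t • v) = ∫⁻ y, S.indicator 1 (y + t • v) := by
      rw [← lintegral_indicator hB]
      refine lintegral_congr fun y => ?_
      by_cases hy : y ∈ B
      · simp [hy]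
      · have : y + t • v ∉ S := fun h => hy (hSB y t ht h)
        simp [hy, this]
    rw [e1, lintegral_add_right_eq_self
        (fun y => S.indicator (1 : (Fin m → ℝ) → ENNReal) y) (t • v),
      lintegral_indicator_one hS]
  have h2 : ∀ y, ∫⁻ t in Set.Icc (0 : ℝ) 1, S.indicator 1 (y + t • v) ≤ ENNReal.ofReal ℓ := by
    intro y
    have hT : MeasurableSet {t : ℝ | y + t • v ∈ S} :=
      (show Measurable fun t : ℝ => y + t • v by fun_prop) hS
    calc ∫⁻ t in Set.Icc (0 : ℝ) 1, S.indicator 1 (y + t • v)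
        ≤ ∫⁻ t, S.indicator 1 (y + t • v) := setLIntegral_le_lintegral _ _
      _ = ∫⁻ t, {t : ℝ | y + t • v ∈ S}.indicator 1 t := rfl
      _ = volume {t : ℝ | y + t • v ∈ S} := lintegral_indicator_one hT
      _ ≤ ENNReal.ofReal ℓ := by
          refine (Real.volume_le_diam _).trans ?_
          refine Metric.ediam_le fun s hs t ht => ?_
          rw [edist_dist, Real.dist_eq]
          refine ENNReal.ofReal_le_ofReal ?_
          rcases le_total s t with h | h
          · rw [abs_sub_comm, abs_of_nonneg (sub_nonneg.2 h)]
            exact hline y s t h hs ht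
          · rw [abs_of_nonneg (sub_nonneg.2 h)]
            exact hline y t s h ht hs
  calc volume S = ∫⁻ t in Set.Icc (0 : ℝ) 1, ∫⁻ y in B, S.indicator 1 (y + t • v) := by
        rw [setLIntegral_congr_fun measurableSet_Icc h1]
        simp
    _ = ∫⁻ y in B, ∫⁻ t in Set.Icc (0 : ℝ) 1, S.indicator 1 (y + t • v) := by
        refine lintegral_lintegral_swap (Measurable.aemeasurable ?_)
        exact (measurable_one.indicator hS).comp hmeas
    _ ≤ ∫⁻ _ in B, ENNReal.ofReal ℓ := lintegral_mono fun y => h2 y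
    _ = ENNReal.ofReal ℓ * volume B := by simp

/-- The point of the hyperplane of the standard simplex with given first coordinates. -/
def snocCompl {m : ℕ} (y : Fin m → ℝ) : Fin (m + 1) → ℝ := Fin.snoc y (1 - ∑ j, y j)

theorem sum_snocCompl {m : ℕ} (y : Fin m → ℝ) : ∑ a, snocCompl y a = 1 := by
  simp [snocCompl, Fin.sum_univ_castSucc]

theorem continuous_snocCompl {m : ℕ} : Continuous (snocCompl (m := m)) := by
  unfold snocCompl
  fun_prop

/-- The entries of `direction i` sum to 0, so the last coordinate moves as it should. -/
theorem snocCompl_add_smul {m : ℕ} (y : Fin m → ℝ) (i : Fin (m + 1)) (t : ℝ) :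
    snocCompl (y + t • fun j => direction i j.castSucc) =
      fun a => snocCompl y a + t * direction i a := by
  have h := sum_direction i
  rw [Fin.sum_univ_castSucc] at h
  funext a
  refine Fin.lastCases ?_ (fun j => ?_) a
  · simp only [snocCompl, Fin.snoc_last, Pi.add_apply, Pi.smul_apply, smul_eq_mul,
      Finset.sum_add_distrib, ← Finset.mul_sum]
    linear_combination -t * h
  · simp [snocCompl]

theorem abs_direction_le {m : ℕ} (i a : Fin (m + 1)) : |direction i a| ≤ m + 1 := by
  unfold direction
  split_ifs
  · simp
  · simp

theorem mem_Icc_of_snocCompl_mem {m : ℕ} {y : Fin m → ℝ}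
    (hy : snocCompl y ∈ stdSimplex ℝ (Fin (m + 1))) (j : Fin m) : y j ∈ Set.Icc (0 : ℝ) 1 := by
  have h1 : snocCompl y j.castSucc = y j := by simp [snocCompl]
  rw [← h1]
  exact ⟨hy.1 _, le_one_of_sum_eq_one hy.1 hy.2 _⟩

theorem measurableSet_solidSimplex (m : ℕ) : MeasurableSet (solidSimplex m) := by
  have : IsClosed (solidSimplex m) := by
    unfold solidSimplex
    simp only [Set.ofPred_and, Set.ofPred_forall]
    exact (isClosed_iInter fun j => isClosed_le continuous_const (continuous_apply j)).inter
      (isClosed_le (by fun_prop) continuous_const)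
  exact this.measurableSet

theorem volume_solidSimplex_pos (m : ℕ) : 0 < volume (solidSimplex m) := by
  have hsub : Set.pi Set.univ (fun _ : Fin m => Set.Icc (0 : ℝ) (1 / (m + 1))) ⊆
      solidSimplex m := by
    intro y hy
    simp only [Set.mem_pi, Set.mem_univ, true_imp_iff] at hy
    refine ⟨fun j => (hy j).1, (Finset.sum_le_sum fun j _ => (hy j).2).trans ?_⟩
    simp only [Finset.sum_const, Finset.card_univ, Fintype.card_fin, nsmul_eq_mul]
    rw [mul_one_div, div_le_one (by positivity)]
    linarith
  refine lt_of_lt_of_le ?_ (measure_mono hsub)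
  rw [volume_pi_pi, CanonicallyOrderedAdd.prod_pos]
  intro j _
  rw [Real.volume_Icc, ENNReal.ofReal_pos, sub_zero]
  positivity

end Geometry

end

end GraphThreshold

/-! ### Measure of the threshold window. -/

namespace GraphThreshold

theorem continuous_expect {ι α : Type*} [Fintype ι] [Fintype α] [DecidableEq ι]
    (f : (ι → α) → ℝ) : Continuous fun m : α → ℝ => expect m f := by
  unfold expect
  fun_prop

/-- Makes the window visibly closed, since `expect` is a polynomial in the weights. -/
theorem setOf_prob_eq {n q : ℕ} (A : EdgePartition n q → Fin q) (i : Fin q) (ε : ℝ) :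
    {μ | μ ∈ stdSimplex ℝ (Fin q) ∧ ε ≤ prob μ A i ∧ prob μ A i ≤ 1 - ε} =
      {μ | μ ∈ stdSimplex ℝ (Fin q) ∧ ε ≤ expect μ (indicatorFn A i) ∧
        expect μ (indicatorFn A i) ≤ 1 - ε} := by
  ext μ
  refine and_congr_right fun hμ => ?_
  rw [prob_eq_expect hμ.1]

theorem simplexMeasure_le {m : ℕ} {S : Set (Fin (m + 1) → ℝ)} (hS : MeasurableSet S) :
    simplexMeasure (m + 1) S ≤ (volume (solidSimplex m))⁻¹ * volume (snocCompl ⁻¹' S) := by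
  change Measure.map snocCompl (ProbabilityTheory.cond volume (solidSimplex m)) S ≤ _
  rw [Measure.map_apply continuous_snocCompl.measurable hS,
    ProbabilityTheory.cond_apply (measurableSet_solidSimplex m)]
  gcongr
  exact Set.inter_subset_right

theorem simplexMeasure_window_le {m n : ℕ} (hn : 3 ≤ n)
    {A : EdgePartition n (m + 1) → Fin (m + 1)} (hA : IsMonotoneGraphProperty A)
    (i : Fin (m + 1)) {ε : ℝ} (hε : 0 < ε) :
    simplexMeasure (m + 1) {μ | μ ∈ stdSimplex ℝ (Fin (m + 1)) ∧
        ε ≤ prob μ A i ∧ prob μ A i ≤ 1 - ε} ≤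
      (volume (solidSimplex m))⁻¹ *
        (ENNReal.ofReal (64 * (Real.log (1 - ε) - Real.log ε) / Real.log n) *
          volume (Set.pi Set.univ fun _ : Fin m => Set.Icc (-(m + 1) : ℝ) (m + 2))) := by
  have hcont := continuous_expect (indicatorFn A i)
  have hclosed : IsClosed {μ | μ ∈ stdSimplex ℝ (Fin (m + 1)) ∧
      ε ≤ expect μ (indicatorFn A i) ∧ expect μ (indicatorFn A i) ≤ 1 - ε} :=
    (isClosed_stdSimplex (𝕜 := ℝ) _).inter ((isClosed_le continuous_const hcont).inter
      (isClosed_le hcont continuous_const))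
  rw [setOf_prob_eq]
  refine (simplexMeasure_le hclosed.measurableSet).trans ?_
  gcongr
  have hlog : 0 < Real.log n := Real.log_pos (by exact_mod_cast (by omega : 1 < n))
  refine volume_le_of_forall_line (fun j => direction i j.castSucc)
    (hclosed.measurableSet.preimage continuous_snocCompl.measurable)
    (MeasurableSet.univ_pi fun _ => measurableSet_Icc) ?_ ?_
  -- Coordinates of the window lie in `[0, 1]` and a shift moves them by at most `m + 1`, whence the
  -- box.
  · rintro y t ⟨ht0, ht1⟩ hy j -
    have h1 := mem_Icc_of_snocCompl_mem hy.1 j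
    have h2 : |t * direction i j.castSucc| ≤ m + 1 := by
      rw [abs_mul, abs_of_nonneg ht0]
      exact (mul_le_of_le_one_left (abs_nonneg _) ht1).trans (abs_direction_le i _)
    have h3 := abs_le.1 h2
    simp only [Pi.add_apply, Pi.smul_apply, smul_eq_mul] at h1
    exact ⟨by linarith [h1.1], by linarith [h1.2]⟩
  · rintro y s t hst ⟨hs0, hs, -⟩ ⟨ht0, -, ht⟩
    rw [snocCompl_add_smul] at hs0 hs ht0 ht
    have h1 := window_le (indicatorFn_eq A i) i (indicatorFn_update_le hA i)
      (siteEnergy_indicatorFn_eq hA.isGraphProperty i) (sum_snocCompl y) hst hε hs0.1 ht0.1 hs ht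
    have h2 : Real.log n ≤ Real.log (Fintype.card (edges n)) :=
      Real.log_le_log (by positivity) (by exact_mod_cast le_card_edges hn)
    rw [le_div_iff₀ hlog]
    nlinarith [mul_le_mul_of_nonneg_right h2 (sub_nonneg.2 hst)]

end GraphThreshold

theorem mainTheorem6 (q : ℕ) :
    ∃ C : ℝ, 0 < C ∧ ∀ n : ℕ, 3 ≤ n →
      ∀ A : GraphThreshold.EdgePartition n q → Fin q, GraphThreshold.IsMonotoneGraphProperty A →
      ∀ (i : Fin q) (ε : ℝ), 0 < ε → ε ≤ 1 / 2 →
        (GraphThreshold.simplexMeasure q).real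
            {μ | μ ∈ stdSimplex ℝ (Fin q) ∧
              ε ≤ GraphThreshold.prob μ A i ∧ GraphThreshold.prob μ A i ≤ 1 - ε} ≤
          C * (Real.log (1 - ε) - Real.log ε) * (Real.log (Real.log n) / Real.log n) := by
  rcases q with _ | m
  · exact ⟨1, one_pos, fun n _ A _ i => i.elim0⟩
  set b := volume (Set.pi Set.univ fun _ : Fin m => Set.Icc (-(m + 1) : ℝ) (m + 2)) with hb
  have hbfin : b ≠ ⊤ := by
    rw [hb, volume_pi_pi]
    exact ENNReal.prod_ne_top fun j _ => by simp
  set s := (volume (GraphThreshold.solidSimplex m))⁻¹ with hs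
  have hsfin : s ≠ ⊤ := ENNReal.inv_ne_top.2 (GraphThreshold.volume_solidSimplex_pos m).ne'
  have hlog3 : 1 < Real.log 3 := by
    rw [Real.lt_log_iff_exp_lt (by norm_num)]
    exact Real.exp_one_lt_d9.trans (by norm_num)
  have hloglog3 : 0 < Real.log (Real.log 3) := Real.log_pos hlog3
  -- The `+ 1` makes the constant visibly positive; dividing by `log log 3` absorbs the factor `log
  -- log n`.
  refine ⟨64 * (s.toReal * b.toReal + 1) / Real.log (Real.log 3), by positivity,
    fun n hn A hA i ε hε hε2 => ?_⟩
  have h3n : Real.log 3 ≤ Real.log n := Real.log_le_log (by norm_num) (by exact_mod_cast hn)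
  have hlog : 0 < Real.log n := by linarith
  have hloglog : Real.log (Real.log 3) ≤ Real.log (Real.log n) :=
    Real.log_le_log (by linarith) h3n
  have hL : 0 ≤ Real.log (1 - ε) - Real.log ε :=
    sub_nonneg.2 (Real.log_le_log hε (by linarith))
  set L := Real.log (1 - ε) - Real.log ε
  have h1 := ENNReal.toReal_mono (by finiteness)
    (GraphThreshold.simplexMeasure_window_le hn hA i hε)
  rw [ENNReal.toReal_mul, ENNReal.toReal_mul, ENNReal.toReal_ofReal (by positivity)] at h1
  refine h1.trans ?_
  calc s.toReal * (64 * L / Real.log n * b.toReal)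
      = 64 * (s.toReal * b.toReal) * L * (1 / Real.log n) := by ring
    _ ≤ 64 * (s.toReal * b.toReal + 1) * L *
        ((Real.log (Real.log n) / Real.log (Real.log 3)) / Real.log n) := by
        gcongr
        · linarith
        · rwa [one_le_div hloglog3]
    _ = _ := by ring
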